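/- Notation. For elements of a group write $x^z=z^{-1}xz$ and $[x,y]=x^{-1}y^{-1}xy$. For a group $G$ let $G^*$ be an isomorphic copy of $G$ via $g\mapsto g^*$, and let $\nu(G)$ be the quotient of the free product $G\star G^*$ by the normal closure of all $[x,y^*]^z[x^z,(y^z)^*]^{-1}$ and $[x,y^*]^{(z^*)}[x^z,(y^z)^*]^{-1}$ with $x,y,z\in G$. Let $\nabla(G)=\langle [x,x^*] : x\in G\rangle\leq \nu(G)$ and $\tau(G)=\nu(G)/\nabla(G)$. The non-abelian exterior square $G\wedge G$ is the subgroup $[G,G^*]$ of $\tau(G)$ generated by the elements $g\wedge h=[g,h^*]$, $g,h\in G$. For $n\ge 2$ let $K(G,n)=\{(g_1,\dots,g_n)\in G^n : g_1\cdots g_n\in G'\}$. If $\pi\colon F\to G$ is a surjective homomorphism from a free group $F$ with kernel $N$, then $\tilde K(G,n)=K(F,n)/K(N,n)^{F^n}$, where $K(N,n)^{F^n}$ is the normal closure of $K(N,n)$ in $F^n$. Proposition. Let $G$ be a finite abelian $2$-group such that the exponent of $G\wedge G$ divides $2$, and let $\pi\colon F\to G$ be any free presentation of $G$, used to define $\tilde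 K(G,3)$. Then $\tau(G)\cong\tilde K(G,3)$. More explicitly: (i) there is an isomorphism from $\tau(G)$ to the group $T$ of all triples $(a,b;c)$ with $a,b\in G$, $c\in G\wedge G$ and multiplication $(a,b;c)(d,e;f)=(ad,be;cf(b\wedge d))$, which maps $g h^* w$ to $(g,h;w)$ for all $g,h\in G$ and $w\in G\wedge G$; (ii) there is an isomorphism from $\tilde K(G,3)$ to the group $L$ of all such triples with multiplication $(a,b;c)(d,e;f)=(ad,be;cf(a\wedge de)(b\wedge e))$, which maps the class of $(f_1,f_2,(f_1f_2)^{-1}[u,v])\in K(F,3)$ to $(\pi(f_1),\pi(f_2);\pi(u)\wedge\pi(v))$ for all $f_1,f_2,u,v\in F$; (iii) whenever $G$ is the internal direct product of cyclic subgroups $\langle x_1\rangle,\dots,\langle x_n\rangle$, there is an isomorphism $\psi\colon T\to L$ such that for all integers $a_1,\dots,a_n,b_1,\dots,b_n$ and all $c\in G\wedge G$, with $a=x_1^{a_1}\cdots x_n^{a_n}$ and $b=x_1^{b_1}\cdots x_n^{b_n}$, $$\psi(a,b;c)=\Bigl(a,b;\,c\prod_{i<j}(x_i\wedge x_j)^{a_ia_j+b_ib_j+a_ib_j-a_jb_i}\Bigr).$$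 -/

import Mathlib

namespace TauK

/-! Conventions: `x ^ z` (conjugation) is `z⁻¹ x z` and `[x, y] = x⁻¹ y⁻¹ x y`. -/

/-- Right conjugate `x^z = z⁻¹ x z`. -/
def rconj {A : Type*} [Group A] (x z : A) : A := z⁻¹ * x * z

/-- Commutator `[x, y] = x⁻¹ y⁻¹ x y`. -/
def rcomm {A : Type*} [Group A] (x y : A) : A := x⁻¹ * y⁻¹ * x * y

section Tau

variable (G : Type*) [Group G]

/-- The free product of `G` with a second copy `G*` of `G`. -/
abbrev FreeSq : Type _ := Monoid.Coprod G G

/-- The relators `[x, y*]^z [x^z, (y^z)*]⁻¹` and `[x, y*]^(z*) [x^z, (y^z)*]⁻¹` of `ν(G)`;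
here `inl x` is `x` and `inr x` is `x*`. -/
def nuRel : Set (FreeSq G) :=
  {w | ∃ x y z : G,
    w = rconj (rcomm (Monoid.Coprod.inl x) (Monoid.Coprod.inr y)) (Monoid.Coprod.inl z) *
        (rcomm (Monoid.Coprod.inl (rconj x z)) (Monoid.Coprod.inr (rconj y z)))⁻¹ ∨
    w = rconj (rcomm (Monoid.Coprod.inl x) (Monoid.Coprod.inr y)) (Monoid.Coprod.inr z) *
        (rcomm (Monoid.Coprod.inl (rconj x z)) (Monoid.Coprod.inr (rconj y z)))⁻¹}

/-- The group `ν(G)`. -/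
abbrev Nu : Type _ := FreeSq G ⧸ Subgroup.normalClosure (nuRel G)

/-- The map `G → ν(G)`, `g ↦ g`. -/
def nuL : G →* Nu G :=
  (QuotientGroup.mk' (Subgroup.normalClosure (nuRel G))).comp Monoid.Coprod.inl

/-- The map `G → ν(G)`, `g ↦ g*`. -/
def nuR : G →* Nu G :=
  (QuotientGroup.mk' (Subgroup.normalClosure (nuRel G))).comp Monoid.Coprod.inr

/-- The subgroup `∇(G)` of `ν(G)` generated by all `[x, x*]`. -/
def nabla : Subgroup (Nu G) :=
  Subgroup.closure (Set.range fun x : G => rcomm (nuL G x) (nuR G x))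

variable {G}

theorem nu_relL (x y z : G) :
    rconj (rcomm (nuL G x) (nuR G y)) (nuL G z) =
      rcomm (nuL G (rconj x z)) (nuR G (rconj y z)) := by
  have h : rconj (rcomm (Monoid.Coprod.inl x) (Monoid.Coprod.inr y)) (Monoid.Coprod.inl z) *
        (rcomm (Monoid.Coprod.inl (rconj x z)) (Monoid.Coprod.inr (rconj y z)))⁻¹ ∈
        Subgroup.normalClosure (nuRel G) :=
    Subgroup.subset_normalClosure ⟨x, y, z, Or.inl rfl⟩
  exact mul_inv_eq_one.mp ((QuotientGroup.eq_one_iff _).mpr h)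

theorem nu_relR (x y z : G) :
    rconj (rcomm (nuL G x) (nuR G y)) (nuR G z) =
      rcomm (nuL G (rconj x z)) (nuR G (rconj y z)) := by
  have h : rconj (rcomm (Monoid.Coprod.inl x) (Monoid.Coprod.inr y)) (Monoid.Coprod.inr z) *
        (rcomm (Monoid.Coprod.inl (rconj x z)) (Monoid.Coprod.inr (rconj y z)))⁻¹ ∈
        Subgroup.normalClosure (nuRel G) :=
    Subgroup.subset_normalClosure ⟨x, y, z, Or.inr rfl⟩
  exact mul_inv_eq_one.mp ((QuotientGroup.eq_one_iff _).mpr h)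

theorem nu_induction {p : Nu G → Prop} (hL : ∀ g, p (nuL G g)) (hR : ∀ g, p (nuR G g))
    (hmul : ∀ a b, p a → p b → p (a * b)) (w : Nu G) : p w := by
  obtain ⟨w, rfl⟩ := QuotientGroup.mk_surjective w
  induction w using Monoid.Coprod.induction_on with
  | inl g => exact hL g
  | inr g => exact hR g
  | mul a b ha hb => exact hmul _ _ ha hb

instance nabla_normal : (nabla G).Normal := by
  have key : ∀ g : Nu G, ∀ n ∈ nabla G, g⁻¹ * n * g ∈ nabla G := by
    intro g
    induction g using nu_induction with
    | hL z =>
      intro n hn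
      induction hn using Subgroup.closure_induction with
      | mem n hn =>
        obtain ⟨x, rfl⟩ := hn
        exact Subgroup.subset_closure ⟨rconj x z, (nu_relL x x z).symm⟩
      | one => simp
      | mul a b _ _ ha hb =>
        have := mul_mem ha hb
        simpa [mul_assoc] using this
      | inv a _ ha =>
        have := inv_mem ha
        simpa [mul_assoc] using this
    | hR z =>
      intro n hn
      induction hn using Subgroup.closure_induction with
      | mem n hn =>
        obtain ⟨x, rfl⟩ := hn
        exact Subgroup.subset_closure ⟨rconj x z, (nu_relR x x z).symm⟩
      | one => simp
      | mul a b _ _ ha hb =>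
        have := mul_mem ha hb
        simpa [mul_assoc] using this
      | inv a _ ha =>
        have := inv_mem ha
        simpa [mul_assoc] using this
    | hmul a b ha hb =>
      intro n hn
      have := hb _ (ha n hn)
      simpa [mul_assoc] using this
  exact ⟨fun n hn g => by simpa using key g⁻¹ n hn⟩

variable (G)

/-- The group `τ(G) = ν(G) / ∇(G)`. -/
abbrev Tau : Type _ := Nu G ⧸ nabla G

/-- The map `G → τ(G)`, `g ↦ g`. -/
def tauL : G →* Tau G := (QuotientGroup.mk' (nabla G)).comp (nuL G)

/-- The map `G → τ(G)`, `g ↦ g*`. -/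
def tauR : G →* Tau G := (QuotientGroup.mk' (nabla G)).comp (nuR G)

/-- The non-abelian exterior square `G ∧ G`, as the subgroup `[G, G*]` of `τ(G)`
generated by all `[g, h*]`. -/
def extSq : Subgroup (Tau G) :=
  Subgroup.closure (Set.range fun p : G × G => rcomm (tauL G p.1) (tauR G p.2))

variable {G}

/-- `g ∧ h = [g, h*]`, computed in `τ(G)`. -/
def wedge (g h : G) : extSq G :=
  ⟨rcomm (tauL G g) (tauR G h), Subgroup.subset_closure ⟨(g, h), rfl⟩⟩

end Tau

section KTilde

/-- `K(G, n)`: the tuples in `G^n` whose product is trivial in `G / G'`. -/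
def K (G : Type*) [Group G] (n : ℕ) : Subgroup (Fin n → G) :=
  (∏ i : Fin n, (Abelianization.of (G := G)).comp (Pi.evalMonoidHom (fun _ => G) i)).ker

variable {F G : Type*} [Group F] [Group G]

/-- `K(N, n)` as a subgroup of `F^n`, for a subgroup `N` of `F`. -/
def KSub (N : Subgroup F) (n : ℕ) : Subgroup (Fin n → F) :=
  (K N n).map (MonoidHom.compLeft N.subtype (Fin n))

/-- `K̃(G, n) = K(F, n) / K(N, n)^(F^n)` for a presentation `π : F → G` with kernel `N`, where
`K(N, n)^(F^n)` is the normal closure of `K(N, n)` in `F^n` (it lies in `K(F, n)`). -/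
abbrev KTilde (π : F →* G) (n : ℕ) : Type _ :=
  K F n ⧸ (Subgroup.normalClosure (KSub π.ker n : Set (Fin n → F))).subgroupOf (K F n)

end KTilde

section Models

/-! For an abelian group `G`, the group `G ∧ G` is central in `τ(G)`, and the symbol `∧` is
bimultiplicative. -/

variable {G : Type*} [CommGroup G]

theorem wedge_comm_L (x y z : G) :
    Commute (rcomm (tauL G x) (tauR G y)) (tauL G z) := by
  have h := congrArg (QuotientGroup.mk' (nabla G)) (nu_relL x y z)
  have h1 : ∀ a : G, rconj a z = a := fun a => by simp [rconj, mul_comm]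
  rw [h1, h1] at h
  have h2 : (tauL G z)⁻¹ * rcomm (tauL G x) (tauR G y) * tauL G z =
      rcomm (tauL G x) (tauR G y) := h
  rw [mul_assoc, inv_mul_eq_iff_eq_mul] at h2
  exact h2

theorem wedge_comm_R (x y z : G) :
    Commute (rcomm (tauL G x) (tauR G y)) (tauR G z) := by
  have h := congrArg (QuotientGroup.mk' (nabla G)) (nu_relR x y z)
  have h1 : ∀ a : G, rconj a z = a := fun a => by simp [rconj, mul_comm]
  rw [h1, h1] at h
  have h2 : (tauR G z)⁻¹ * rcomm (tauL G x) (tauR G y) * tauR G z =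
      rcomm (tauL G x) (tauR G y) := h
  rw [mul_assoc, inv_mul_eq_iff_eq_mul] at h2
  exact h2

theorem extSq_comm {a b : Tau G} (ha : a ∈ extSq G) (hb : b ∈ extSq G) : Commute a b := by
  induction ha using Subgroup.closure_induction with
  | one => exact Commute.one_left b
  | mul x y _ _ hx hy => exact hx.mul_left hy
  | inv x _ hx => exact hx.inv_left
  | mem x hx =>
    obtain ⟨⟨g, h⟩, rfl⟩ := hx
    obtain ⟨b, rfl⟩ := QuotientGroup.mk_surjective b
    clear hb
    induction b using nu_induction with
    | hL z => exact wedge_comm_L g h z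
    | hR z => exact wedge_comm_R g h z
    | hmul c d hc hd => exact Commute.mul_right hc hd

instance extSq_commGroup : CommGroup (extSq G) :=
  { (inferInstance : Group (extSq G)) with
    mul_comm := fun a b => Subtype.ext (extSq_comm a.2 b.2) }

theorem wedge_mul_left (x y z : G) : wedge (x * y) z = wedge x z * wedge y z := by
  apply Subtype.ext
  have h := (wedge_comm_L x z y).eq
  simp only [wedge, rcomm, map_mul, Subgroup.coe_mul] at h ⊢
  have h' : (tauL G x)⁻¹ * (tauR G z)⁻¹ * tauL G x * tauR G z =
      (tauL G y)⁻¹ * ((tauL G x)⁻¹ * (tauR G z)⁻¹ * tauL G x * tauR G z * tauL G y) := by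
    rw [h, inv_mul_cancel_left]
  rw [h']
  group

theorem wedge_mul_right (x y z : G) : wedge x (y * z) = wedge x y * wedge x z := by
  apply Subtype.ext
  have h := (wedge_comm_R x y z).eq
  have hc := extSq_comm (wedge x y).2 (wedge x z).2
  rw [Subgroup.coe_mul, hc.eq]
  simp only [wedge, rcomm, map_mul] at h ⊢
  have h' : (tauL G x)⁻¹ * (tauR G y)⁻¹ * tauL G x * tauR G y =
      (tauR G z)⁻¹ * ((tauL G x)⁻¹ * (tauR G y)⁻¹ * tauL G x * tauR G y * tauR G z) := by
    rw [h, inv_mul_cancel_left]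
  rw [h']
  group

theorem wedge_one_left (x : G) : wedge 1 x = 1 := by
  apply Subtype.ext
  simp [wedge, rcomm]

/-- The set of triples `(a, b; c)` with `a, b ∈ G` and `c ∈ G ∧ G`, carrying the group
structure `(a, b; c)(d, e; f) = (ad, be; cf(b ∧ d))`. -/
@[ext] structure TauModel (G : Type*) [CommGroup G] where
  a : G
  b : G
  c : extSq G

/-- The set of triples `(a, b; c)` with `a, b ∈ G` and `c ∈ G ∧ G`, carrying the group
structure `(a, b; c)(d, e; f) = (ad, be; cf(a ∧ de)(b ∧ e))`. -/
@[ext] structure KModel (G : Type*) [CommGroup G] where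
  a : G
  b : G
  c : extSq G

instance : Mul (TauModel G) :=
  ⟨fun u v => ⟨u.a * v.a, u.b * v.b, u.c * v.c * wedge u.b v.a⟩⟩

instance : One (TauModel G) := ⟨⟨1, 1, 1⟩⟩

instance : Inv (TauModel G) := ⟨fun u => ⟨u.a⁻¹, u.b⁻¹, u.c⁻¹ * (wedge u.b⁻¹ u.a)⁻¹⟩⟩

instance : Mul (KModel G) :=
  ⟨fun u v => ⟨u.a * v.a, u.b * v.b,
    u.c * v.c * wedge u.a (v.a * v.b) * wedge u.b v.b⟩⟩

instance : One (KModel G) := ⟨⟨1, 1, 1⟩⟩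

instance : Inv (KModel G) := ⟨fun u => ⟨u.a⁻¹, u.b⁻¹,
  u.c⁻¹ * (wedge u.a⁻¹ (u.a * u.b))⁻¹ * (wedge u.b⁻¹ u.b)⁻¹⟩⟩

instance : Group (TauModel G) :=
  Group.ofLeftAxioms
    (by
      intro u v w
      refine TauModel.ext (mul_assoc _ _ _) (mul_assoc _ _ _) ?_
      change u.c * v.c * wedge u.b v.a * w.c * wedge (u.b * v.b) w.a =
        u.c * (v.c * w.c * wedge v.b w.a) * wedge u.b (v.a * w.a)
      rw [wedge_mul_left, wedge_mul_right]
      generalize wedge u.b v.a = p, wedge u.b w.a = q, wedge v.b w.a = r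
      generalize u.c = x, v.c = y, w.c = z
      ac_rfl)
    (by
      intro u
      refine TauModel.ext (one_mul _) (one_mul _) ?_
      change 1 * u.c * wedge 1 u.a = u.c
      rw [wedge_one_left, one_mul, mul_one])
    (by
      intro u
      refine TauModel.ext (inv_mul_cancel _) (inv_mul_cancel _) ?_
      change u.c⁻¹ * (wedge u.b⁻¹ u.a)⁻¹ * u.c * wedge u.b⁻¹ u.a = 1
      rw [mul_right_comm u.c⁻¹, inv_mul_cancel, one_mul, inv_mul_cancel])

instance : Group (KModel G) :=
  Group.ofLeftAxioms
    (by
      intro u v w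
      refine KModel.ext (mul_assoc _ _ _) (mul_assoc _ _ _) ?_
      change (u.c * v.c * wedge u.a (v.a * v.b) * wedge u.b v.b) * w.c *
          wedge (u.a * v.a) (w.a * w.b) * wedge (u.b * v.b) w.b =
        u.c * (v.c * w.c * wedge v.a (w.a * w.b) * wedge v.b w.b) *
          wedge u.a (v.a * w.a * (v.b * w.b)) * wedge u.b (v.b * w.b)
      simp only [wedge_mul_left, wedge_mul_right]
      generalize wedge u.a v.a = p1, wedge u.a v.b = p2, wedge u.a w.a = p3,
        wedge u.a w.b = p4, wedge v.a w.a = p5, wedge v.a w.b = p6, wedge u.b v.b = p7,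
        wedge u.b w.b = p8, wedge v.b w.b = p9
      generalize u.c = x, v.c = y, w.c = z
      ac_rfl)
    (by
      intro u
      refine KModel.ext (one_mul _) (one_mul _) ?_
      change 1 * u.c * wedge 1 (u.a * u.b) * wedge 1 u.b = u.c
      simp only [wedge_one_left, one_mul, mul_one])
    (by
      intro u
      refine KModel.ext (inv_mul_cancel _) (inv_mul_cancel _) ?_
      change u.c⁻¹ * (wedge u.a⁻¹ (u.a * u.b))⁻¹ * (wedge u.b⁻¹ u.b)⁻¹ * u.c *
        wedge u.a⁻¹ (u.a * u.b) * wedge u.b⁻¹ u.b = 1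
      rw [mul_right_comm _ _ u.c, mul_right_comm _ _ u.c, inv_mul_cancel, one_mul,
        mul_right_comm (wedge u.a⁻¹ (u.a * u.b))⁻¹, inv_mul_cancel, one_mul, inv_mul_cancel])

end Models

end TauK

namespace TauK

open scoped commutatorElement

/-! ### Commutators in an arbitrary group -/

section Commutators

variable {A B : Type*} [Group A] [Group B]

/-! Since `G` is abelian, `G ∧ G` is central in `τ(G)` and `∧` is the universal alternating
bimultiplicative map on `G`. Every element of `τ(G)` then has the form `g h* w`, and mapping `τ(G)`
onto `T` shows that this form is unique (`exists_tau_equiv`).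

For `K̃(G, 3)`, split `G` into cyclic factors. As `∧` vanishes on each factor, it is the skew part
`β(x, y) β(y, x)⁻¹` of its strictly upper triangular part `β` (`exists_triangular_pairing`). The
central extension of `G` by `G ∧ G` with cocycle `β` therefore has commutator pairing `∧`. Freeness
of `F` lifts `π` to a map `lam` into it, and the second component of `lam (k 0 * k 1 * k 2)` gives
the third coordinate of a homomorphism from `K(F, 3)` onto `L` (`toKModel`).

Its kernel is the normal closure of `K(N, 3)` (`ker_toKModel`). Commutation in `F / [N, F]` induces
a map on `G ∧ G` which recovers `w ∈ F'` modulo `[N, F]` from `lam w`. So a tuple in the kernel has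
`k 0, k 1 ∈ N` and product in `[N, F]`, and such tuples are built from conjugates of elements of
`K(N, 3)`.

Finally `T` and `L` are extensions of `G × G` by `G ∧ G`. When squares in `G ∧ G` are trivial, their
cocycles differ by the coboundary of a quadratic function built from `β` (`exists_model_equiv`).
Only this last comparison needs the exponent condition. -/

theorem rcomm_eq (x y : A) : rcomm x y = (y * x)⁻¹ * (x * y) := by
  simp [rcomm, mul_assoc]

theorem map_rcomm (f : A →* B) (x y : A) : f (rcomm x y) = rcomm (f x) (f y) := by
  simp [rcomm]

theorem rcomm_comm (x y : A) : rcomm x y = (rcomm y x)⁻¹ := by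
  simp [rcomm, mul_assoc]

theorem commutator_eq_closure_rcomm :
    commutator A = Subgroup.closure (Set.range fun p : A × A => rcomm p.1 p.2) := by
  rw [commutator_eq_closure]
  congr 1
  ext w
  constructor
  · rintro ⟨a, b, rfl⟩
    exact ⟨(a⁻¹, b⁻¹), by simp [rcomm, commutatorElement_def]⟩
  · rintro ⟨⟨a, b⟩, rfl⟩
    exact ⟨a⁻¹, b⁻¹, by simp [rcomm, commutatorElement_def]⟩

theorem rcomm_mem_commutator (x y : A) : rcomm x y ∈ commutator A := by
  rw [commutator_eq_closure_rcomm]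
  exact Subgroup.subset_closure ⟨(x, y), rfl⟩

end Commutators

/-! ### Central extensions with bimultiplicative cocycle -/

/-- The central extension of `H` by `A` whose cocycle is the bimultiplicative map `β`. -/
@[ext] structure BiExt {H A : Type*} [CommGroup H] [CommGroup A] (β : H →* H →* A) where
  fst : H
  snd : A

namespace BiExt

variable {H A : Type*} [CommGroup H] [CommGroup A] {β : H →* H →* A}

instance : Mul (BiExt β) := ⟨fun u v => ⟨u.fst * v.fst, u.snd * v.snd * β u.fst v.fst⟩⟩

instance : One (BiExt β) := ⟨⟨1, 1⟩⟩

/-- The factor `β u.fst u.fst` cancels the cocycle value `β u.fst⁻¹ u.fst`. -/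
instance : Inv (BiExt β) := ⟨fun u => ⟨u.fst⁻¹, u.snd⁻¹ * β u.fst u.fst⟩⟩

@[simp] theorem mul_fst (u v : BiExt β) : (u * v).fst = u.fst * v.fst := rfl

@[simp] theorem mul_snd (u v : BiExt β) : (u * v).snd = u.snd * v.snd * β u.fst v.fst := rfl

@[simp] theorem one_fst : (1 : BiExt β).fst = 1 := rfl

@[simp] theorem one_snd : (1 : BiExt β).snd = 1 := rfl

@[simp] theorem inv_fst (u : BiExt β) : (u⁻¹).fst = u.fst⁻¹ := rfl

@[simp] theorem inv_snd (u : BiExt β) : (u⁻¹).snd = u.snd⁻¹ * β u.fst u.fst := rfl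

instance : Group (BiExt β) :=
  Group.ofLeftAxioms
    (fun u v w => BiExt.ext (mul_assoc _ _ _) (by
      simp only [mul_snd, mul_fst, map_mul, MonoidHom.mul_apply]
      simp only [mul_assoc, mul_comm, mul_left_comm]))
    (fun u => BiExt.ext (one_mul _) (by simp))
    (fun u => BiExt.ext (inv_mul_cancel _) (by simp))

/-- The products `uv` and `vu` differ only in their cocycle values, so commutators see exactly the
skew part of `β`. -/
theorem rcomm_def (u v : BiExt β) :
    rcomm u v = ⟨1, β u.fst v.fst * (β v.fst u.fst)⁻¹⟩ := by
  rw [rcomm_eq, inv_mul_eq_iff_eq_mul]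
  refine BiExt.ext (by simp [mul_comm]) ?_
  simp only [mul_snd, mul_fst, map_one, mul_one]
  rw [mul_comm u.snd, mul_assoc _ (β v.fst u.fst), mul_comm (β u.fst v.fst),
    mul_inv_cancel_left]

theorem commute_of_fst_eq_one {u : BiExt β} (hu : u.fst = 1) (v : BiExt β) : Commute u v := by
  refine BiExt.ext (mul_comm _ _) ?_
  simp [hu, mul_comm]

/-- The projection to the first component. -/
def fstHom (β : H →* H →* A) : BiExt β →* H := MonoidHom.mk' BiExt.fst fun _ _ => rfl

end BiExt

/-! ### Universal properties of `τ(G)` and `G ∧ G` -/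

section Wedge

variable {G : Type*} [CommGroup G]

theorem wedge_self (x : G) : wedge x x = 1 := by
  apply Subtype.ext
  exact (QuotientGroup.eq_one_iff _).mpr (Subgroup.subset_closure ⟨x, rfl⟩)

/-- The symbol `∧` as a bimultiplicative map. -/
def wedgeHom (G : Type*) [CommGroup G] : G →* G →* extSq G :=
  MonoidHom.mk' (fun x => MonoidHom.mk' (wedge x) (wedge_mul_right x))
    fun x y => MonoidHom.ext fun z => wedge_mul_left x y z

@[simp] theorem wedgeHom_apply (x y : G) : wedgeHom G x y = wedge x y := rfl

/-- Expand `b (x * y) (x * y) = 1`. -/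
theorem alternating_swap {A : Type*} [CommGroup A] (b : G →* G →* A) (hb : ∀ x, b x x = 1)
    (x y : G) : b x y = (b y x)⁻¹ := by
  have h := hb (x * y)
  simp only [map_mul, MonoidHom.mul_apply, hb, one_mul, mul_one] at h
  exact eq_inv_of_mul_eq_one_right h

theorem wedge_swap (x y : G) : wedge x y = (wedge y x)⁻¹ :=
  alternating_swap (wedgeHom G) wedge_self x y

theorem extSq_induction {p : extSq G → Prop} (hw : ∀ g h, p (wedge g h)) (h1 : p 1)
    (hmul : ∀ a b, p a → p b → p (a * b)) (hinv : ∀ a, p a → p a⁻¹) (c : extSq G) : p c := by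
  obtain ⟨c, hc⟩ := c
  induction hc using Subgroup.closure_induction with
  | mem x hx => obtain ⟨⟨g, h⟩, rfl⟩ := hx; exact hw g h
  | one => exact h1
  | mul x y hx hy ihx ihy => exact hmul ⟨x, hx⟩ ⟨y, hy⟩ ihx ihy
  | inv x hx ih => exact hinv ⟨x, hx⟩ ih

theorem rconj_eq_self (x y : G) : rconj x y = x := by simp [rconj, mul_comm]

/-- The universal property of `τ(G)` for an abelian group `G`. -/
theorem exists_tau_lift {P : Type*} [Group P] (f g : G →* P)
    (hf : ∀ x y z, Commute (rcomm (f x) (g y)) (f z))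
    (hg : ∀ x y z, Commute (rcomm (f x) (g y)) (g z))
    (hd : ∀ x, rcomm (f x) (g x) = 1) :
    ∃ φ : Tau G →* P, (∀ x, φ (tauL G x) = f x) ∧ ∀ x, φ (tauR G x) = g x := by
  have h1 : Subgroup.normalClosure (nuRel G) ≤ (Monoid.Coprod.lift f g).ker := by
    refine Subgroup.normalClosure_le_normal ?_
    rintro w ⟨x, y, z, rfl | rfl⟩
    · have h := (hf x y z).eq
      rw [rconj_eq_self x z, rconj_eq_self y z]
      simp only [SetLike.mem_coe, MonoidHom.mem_ker, map_mul, map_inv, map_rcomm,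
        Monoid.Coprod.lift_apply_inl, Monoid.Coprod.lift_apply_inr, rconj]
      rw [mul_assoc _ _ (f z), h, inv_mul_cancel_left, mul_inv_cancel]
    · have h := (hg x y z).eq
      rw [rconj_eq_self x z, rconj_eq_self y z]
      simp only [SetLike.mem_coe, MonoidHom.mem_ker, map_mul, map_inv, map_rcomm,
        Monoid.Coprod.lift_apply_inl, Monoid.Coprod.lift_apply_inr, rconj]
      rw [mul_assoc _ _ (g z), h, inv_mul_cancel_left, mul_inv_cancel]
  let φ₁ : Nu G →* P := QuotientGroup.lift _ (Monoid.Coprod.lift f g) h1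
  have hL : ∀ x, φ₁ (nuL G x) = f x := fun x => Monoid.Coprod.lift_apply_inl f g x
  have hR : ∀ x, φ₁ (nuR G x) = g x := fun x => Monoid.Coprod.lift_apply_inr f g x
  have h2 : nabla G ≤ φ₁.ker := by
    refine (Subgroup.closure_le _).mpr ?_
    rintro _ ⟨x, rfl⟩
    simp only [SetLike.mem_coe, MonoidHom.mem_ker, map_rcomm, hL, hR, hd]
  exact ⟨QuotientGroup.lift _ φ₁ h2, hL, hR⟩

/-- The universal property of `G ∧ G` for an abelian group `G`. -/
theorem exists_extSq_lift {A : Type*} [CommGroup A] (b : G →* G →* A) (hb : ∀ x, b x x = 1) :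
    ∃ φ : extSq G →* A, ∀ x y, φ (wedge x y) = b x y := by
  -- The cocycle pairs the starred coordinate of the left factor with the unstarred one of the
  -- right. It vanishes on each copy of `G`, so both embed as subgroups, and `[x, y*]` becomes `(b y
  -- x)⁻¹ = b x y`.
  let β : G × G →* G × G →* A :=
    MonoidHom.mk' (fun u => (b u.2).comp (MonoidHom.fst G G)) fun u v => by
      ext w; simp
  have hβ : ∀ u v, β u v = b u.2 v.1 := fun _ _ => rfl
  let f : G →* BiExt β := MonoidHom.mk' (fun x => ⟨(x, 1), 1⟩) fun x y =>
    BiExt.ext (by simp) (by simp [hβ])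
  let g : G →* BiExt β := MonoidHom.mk' (fun x => ⟨(1, x), 1⟩) fun x y =>
    BiExt.ext (by simp) (by simp [hβ])
  have hfg : ∀ x y, rcomm (f x) (g y) = ⟨1, b x y⟩ := by
    intro x y
    rw [BiExt.rcomm_def, hβ, hβ, alternating_swap b hb x y]
    simp [f, g]
  obtain ⟨φ, hL, hR⟩ := exists_tau_lift f g
    (fun x y z => BiExt.commute_of_fst_eq_one (by rw [hfg]) _)
    (fun x y z => BiExt.commute_of_fst_eq_one (by rw [hfg]) _)
    (fun x => by rw [hfg, hb]; rfl)
  have hw : ∀ x y, φ (wedge x y) = ⟨1, b x y⟩ := fun x y => by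
    rw [← hfg, ← hL, ← hR, ← map_rcomm]; rfl
  have h1 : ∀ c : extSq G, (φ c).fst = 1 := by
    intro c
    induction c using extSq_induction with
    | hw x y => rw [hw]
    | h1 => simp
    | hmul a b ha hb => simp [ha, hb]
    | hinv a ha => simp [ha]
  refine ⟨MonoidHom.mk' (fun c => (φ c).snd) fun c d => by simp [h1], fun x y => ?_⟩
  simp [hw]

end Wedge

/-! ### The isomorphism of `τ(G)` with `T` -/

section TauModelIso

variable {G : Type*} [CommGroup G]

namespace TauModel

@[simp] theorem mul_def (u v : TauModel G) :
    u * v = ⟨u.a * v.a, u.b * v.b, u.c * v.c * wedge u.b v.a⟩ := rfl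

theorem one_def : (1 : TauModel G) = ⟨1, 1, 1⟩ := rfl

end TauModel

theorem wedge_one_right (x : G) : wedge x 1 = 1 := map_one (wedgeHom G x)

/-- The group `τ(G)` of an abelian group `G` is isomorphic to its model. -/
theorem exists_tau_equiv (G : Type*) [CommGroup G] : ∃ e : Tau G ≃* TauModel G,
    ∀ (g h : G) (w : extSq G), e (tauL G g * tauR G h * (w : Tau G)) = ⟨g, h, w⟩ := by
  let f : G →* TauModel G := MonoidHom.mk' (fun x => ⟨x, 1, 1⟩) fun x y => by
    simp [wedge_one_left]
  let g : G →* TauModel G := MonoidHom.mk' (fun x => ⟨1, x, 1⟩) fun x y => by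
    simp [wedge_one_right]
  have hfg : ∀ x y, rcomm (f x) (g y) = ⟨1, 1, wedge x y⟩ := by
    intro x y
    rw [rcomm_eq, inv_mul_eq_iff_eq_mul, wedge_swap x y]
    simp [f, g, wedge_one_right]
  have hc : ∀ (c : extSq G) (u : TauModel G), Commute ⟨1, 1, c⟩ u := by
    intro c u
    change _ * _ = _ * _
    simp [wedge_one_left, wedge_one_right, mul_comm]
  obtain ⟨φ, hL, hR⟩ := exists_tau_lift f g
    (fun x y z => by rw [hfg]; exact hc _ _) (fun x y z => by rw [hfg]; exact hc _ _)
    (fun x => by rw [hfg, wedge_self]; rfl)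
  have hw : ∀ c : extSq G, φ c = ⟨1, 1, c⟩ := by
    intro c
    induction c using extSq_induction with
    | hw x y => rw [← hfg, ← hL, ← hR, ← map_rcomm]; rfl
    | h1 => simp [TauModel.one_def]
    | hmul a b ha hb => simp [ha, hb, wedge_one_left]
    | hinv a ha =>
      rw [Subgroup.coe_inv, map_inv, ha, inv_eq_iff_mul_eq_one]
      simp [wedge_one_left, TauModel.one_def]
  have hφ : ∀ (g h : G) (w : extSq G), φ (tauL G g * tauR G h * (w : Tau G)) = ⟨g, h, w⟩ := by
    intro x y w
    simp [hL, hR, hw, f, g, wedge_one_right]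
  -- Normal form: moving `y*` past `x` costs the central factor `y ∧ x`, so elements `g h* w` are
  -- closed under multiplication. Injectivity follows because `φ` reads off `g`, `h` and `w`.
  have hsurj : ∀ t : Tau G, ∃ (g h : G) (w : extSq G), t = tauL G g * tauR G h * (w : Tau G) := by
    have hcen : ∀ (w : extSq G) (t : Tau G), Commute (w : Tau G) t := by
      intro w t
      induction w using extSq_induction with
      | hw x y =>
        obtain ⟨t, rfl⟩ := QuotientGroup.mk_surjective t
        induction t using nu_induction with
        | hL z => exact wedge_comm_L x y z
        | hR z => exact wedge_comm_R x y z
        | hmul c d hc hd => exact Commute.mul_right hc hd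
      | h1 => exact Commute.one_left _
      | hmul a b ha hb => exact Commute.mul_left ha hb
      | hinv a ha => exact Commute.inv_left ha
    have hsw : ∀ x y : G, tauR G y * tauL G x =
        tauL G x * tauR G y * ((wedge y x : extSq G) : Tau G) := by
      intro x y
      rw [wedge_swap]
      simp [wedge, rcomm, mul_assoc]
    intro t
    obtain ⟨t, rfl⟩ := QuotientGroup.mk_surjective t
    induction t using nu_induction with
    | hL z => exact ⟨z, 1, 1, by simp; rfl⟩
    | hR z => exact ⟨1, z, 1, by simp; rfl⟩
    | hmul c d hc hd =>
      obtain ⟨x, y, w, h1⟩ := hc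
      obtain ⟨x', y', w', h2⟩ := hd
      refine ⟨x * x', y * y', wedge y x' * w * w', ?_⟩
      change (c : Tau G) * (d : Tau G) = _
      rw [h1, h2]
      simp only [map_mul, Subgroup.coe_mul]
      calc tauL G x * tauR G y * (w : Tau G) * (tauL G x' * tauR G y' * (w' : Tau G))
          = tauL G x * tauR G y * ((w : Tau G) * (tauL G x' * tauR G y')) * (w' : Tau G) := by
            simp only [mul_assoc]
        _ = tauL G x * (tauR G y * tauL G x') * tauR G y' * w * w' := by
            rw [(hcen w _).eq]; simp only [mul_assoc]
        _ = tauL G x * tauL G x' * tauR G y * (((wedge y x' : extSq G) : Tau G) * tauR G y')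
              * w * w' := by
            rw [hsw]; simp only [mul_assoc]
        _ = _ := by
            rw [(hcen _ _).eq]; simp only [mul_assoc]
  refine ⟨MulEquiv.ofBijective φ ⟨?_, ?_⟩, hφ⟩
  · intro t t' htt
    obtain ⟨x, y, w, rfl⟩ := hsurj t
    obtain ⟨x', y', w', rfl⟩ := hsurj t'
    rw [hφ, hφ] at htt
    injection htt with h1 h2 h3
    rw [h1, h2, h3]
  · rintro ⟨x, y, w⟩
    exact ⟨_, hφ x y w⟩

end TauModelIso

open scoped IsMulCommutative

/-! ### The commutator pairing of a central extension -/

section CommutatorPairing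

variable {Q G : Type*} [Group Q] [CommGroup G]

theorem map_rcomm_eq_one (p : Q →* G) (x y : Q) : p (rcomm x y) = 1 := by
  rw [map_rcomm, rcomm_eq, mul_comm (p y), inv_mul_cancel]

theorem rcomm_mul_left {x y z : Q} (h : Commute (rcomm x z) y) :
    rcomm (x * y) z = rcomm x z * rcomm y z := by
  have h' : x⁻¹ * z⁻¹ * x * z = y⁻¹ * (x⁻¹ * z⁻¹ * x * z * y) := by
    have := h.eq
    unfold rcomm at this
    rw [this, inv_mul_cancel_left]
  unfold rcomm
  rw [h']
  group

theorem rcomm_mul_right {x y z : Q} (h : Commute (rcomm x y) z)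
    (h' : Commute (rcomm x y) (rcomm x z)) :
    rcomm x (y * z) = rcomm x y * rcomm x z := by
  rw [rcomm_comm x (y * z), rcomm_mul_left, mul_inv_rev, ← rcomm_comm, ← rcomm_comm, h'.eq]
  rw [rcomm_comm]
  exact h.inv_left

/-- A central extension of an abelian group induces a commutator pairing. -/
theorem exists_commutator_pairing (p : Q →* G) (hp : Function.Surjective p)
    (hker : p.ker ≤ Subgroup.center Q) :
    ∃ b : G →* G →* Subgroup.center Q, ∀ x y, (b (p x) (p y) : Q) = rcomm x y := by
  have hcen : ∀ x y z : Q, Commute (rcomm x y) z := fun x y z =>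
    (Subgroup.mem_center_iff.mp (hker (map_rcomm_eq_one p x y)) z).symm
  have hL : ∀ x x' y, p x = p x' → rcomm x y = rcomm x' y := by
    intro x x' y h
    have h1 : x'⁻¹ * x ∈ Subgroup.center Q := hker (by simp [MonoidHom.mem_ker, h])
    have h2 : rcomm (x'⁻¹ * x) y = 1 := by
      rw [rcomm_eq, Subgroup.mem_center_iff.mp h1 y, inv_mul_cancel]
    rw [show x = x' * (x'⁻¹ * x) by simp, rcomm_mul_left (hcen _ _ _), h2, mul_one]
  have hR : ∀ x y y', p y = p y' → rcomm x y = rcomm x y' := by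
    intro x y y' h
    rw [rcomm_comm, hL y y' x h, ← rcomm_comm]
  -- Any set-theoretic section will do: by `hL` and `hR` the commutator depends only on the images
  -- in `G`.
  let s := Function.surjInv hp
  have hs : ∀ g, p (s g) = g := Function.surjInv_eq hp
  let b₀ : G → G → Subgroup.center Q := fun g h =>
    ⟨rcomm (s g) (s h), hker (map_rcomm_eq_one p _ _)⟩
  have hml : ∀ g g' h, b₀ (g * g') h = b₀ g h * b₀ g' h := fun g g' h => by
    apply Subtype.ext
    change rcomm _ _ = rcomm _ _ * rcomm _ _
    rw [← rcomm_mul_left (hcen _ _ _)]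
    exact hL _ _ _ (by simp [hs])
  have hmr : ∀ g h h', b₀ g (h * h') = b₀ g h * b₀ g h' := fun g h h' => by
    apply Subtype.ext
    change rcomm _ _ = rcomm _ _ * rcomm _ _
    rw [← rcomm_mul_right (hcen _ _ _) (hcen _ _ _)]
    exact hR _ _ _ (by simp [hs])
  refine ⟨MonoidHom.mk' (fun g => MonoidHom.mk' (b₀ g) (hmr g)) fun g g' =>
    MonoidHom.ext fun h => hml g g' h, fun x y => ?_⟩
  change rcomm (s (p x)) (s (p y)) = rcomm x y
  rw [hL _ x _ (hs _), hR _ _ y (hs _)]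

end CommutatorPairing

/-! ### Free presentations and the isomorphism of `K̃(G, 3)` with `L` -/

section Presentation

variable {F G : Type*} [Group F] [CommGroup G]

/-- For a presentation of an abelian group, the commutator map sends `g ∧ h` to a commutator in
the free central extension. -/
theorem exists_extSq_to_quotient (π : F →* G) (hπ : Function.Surjective π) :
    ∃ φ : extSq G →* Subgroup.center (F ⧸ ⁅π.ker, (⊤ : Subgroup F)⁆), ∀ u v : F,
      (φ (wedge (π u) (π v)) : F ⧸ ⁅π.ker, (⊤ : Subgroup F)⁆) = (rcomm u v : F) := by
  let M : Subgroup F := ⁅π.ker, (⊤ : Subgroup F)⁆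
  have hM : M ≤ π.ker := Subgroup.commutator_le_left _ _
  let p : F ⧸ M →* G := QuotientGroup.lift M π hM
  have hp : Function.Surjective p := fun g => by
    obtain ⟨f, rfl⟩ := hπ g
    exact ⟨(f : F ⧸ M), rfl⟩
  have hker : p.ker ≤ Subgroup.center (F ⧸ M) := by
    intro x hx
    obtain ⟨x, rfl⟩ := QuotientGroup.mk_surjective x
    rw [Subgroup.mem_center_iff]
    intro y
    obtain ⟨y, rfl⟩ := QuotientGroup.mk_surjective y
    have h : ⁅x, y⁆ ∈ M := Subgroup.commutator_mem_commutator hx (Subgroup.mem_top y)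
    have h1 := (QuotientGroup.eq_one_iff (N := M) _).mpr h
    exact (commutatorElement_eq_one_iff_mul_comm.mp h1).symm
  obtain ⟨b, hb⟩ := exists_commutator_pairing p hp hker
  -- The pairing is alternating because every element commutes with itself, so it factors through `G
  -- ∧ G`.
  obtain ⟨φ, hφ⟩ := exists_extSq_lift b fun g => by
    obtain ⟨x, rfl⟩ := hp g
    apply Subtype.ext
    rw [hb]
    simp [rcomm]
  refine ⟨φ, fun u v => ?_⟩
  rw [hφ]
  exact (hb (u : F ⧸ M) (v : F ⧸ M)).trans
    (map_rcomm (QuotientGroup.mk' M) u v).symm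

variable {β : G →* G →* extSq G} {π : F →* G} {lam : F →* BiExt β}

theorem lift_rcomm (hβ : ∀ x y, β x y * (β y x)⁻¹ = wedge x y)
    (hlam : ∀ f, (lam f).fst = π f) (u v : F) :
    lam (rcomm u v) = ⟨1, wedge (π u) (π v)⟩ := by
  rw [map_rcomm, BiExt.rcomm_def, hβ, hlam, hlam]

/-- Elements of the derived subgroup with trivial image in `G ∧ G` lie in `[N, F]`. -/
theorem mem_commutator_ker_of_snd_eq_one (hπ : Function.Surjective π)
    (hβ : ∀ x y, β x y * (β y x)⁻¹ = wedge x y) (hlam : ∀ f, (lam f).fst = π f)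
    {w : F} (hw : w ∈ commutator F) (h1 : (lam w).snd = 1) :
    w ∈ ⁅π.ker, (⊤ : Subgroup F)⁆ := by
  obtain ⟨φ, hφ⟩ := exists_extSq_to_quotient π hπ
  -- On `F'`, `φ` applied to the second component of `lam` recovers the class modulo `[N, F]`.
  -- Checking this on commutators suffices, since `lam` takes values in the central subgroup `fst =
  -- 1` there and is multiplicative in the second component.
  have key : (lam w).fst = 1 ∧
      (φ (lam w).snd : F ⧸ ⁅π.ker, (⊤ : Subgroup F)⁆) = (w : F) := by
    clear h1
    rw [commutator_eq_closure_rcomm] at hw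
    induction hw using Subgroup.closure_induction with
    | mem x hx =>
      obtain ⟨⟨u, v⟩, rfl⟩ := hx
      rw [lift_rcomm hβ hlam]
      exact ⟨rfl, hφ u v⟩
    | one => simp
    | mul x y _ _ hx hy => simp [hx.1, hy.1, hx.2, hy.2]
    | inv x _ hx => simp [hx.1, hx.2]
  rw [h1, map_one] at key
  exact (QuotientGroup.eq_one_iff _).mp key.2.symm

theorem exists_mem_commutator_snd_eq (hπ : Function.Surjective π)
    (hβ : ∀ x y, β x y * (β y x)⁻¹ = wedge x y) (hlam : ∀ f, (lam f).fst = π f)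
    (c : extSq G) : ∃ w ∈ commutator F, lam w = ⟨1, c⟩ := by
  induction c using extSq_induction with
  | hw g h =>
    obtain ⟨u, rfl⟩ := hπ g
    obtain ⟨v, rfl⟩ := hπ h
    exact ⟨_, rcomm_mem_commutator u v, lift_rcomm hβ hlam u v⟩
  | h1 => exact ⟨1, one_mem _, map_one _⟩
  | hmul a b ha hb =>
    obtain ⟨x, hx, hx'⟩ := ha
    obtain ⟨y, hy, hy'⟩ := hb
    exact ⟨x * y, mul_mem hx hy, by rw [map_mul, hx', hy']; ext <;> simp⟩
  | hinv a ha =>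
    obtain ⟨x, hx, hx'⟩ := ha
    exact ⟨x⁻¹, inv_mem hx, by rw [map_inv, hx']; ext <;> simp⟩

theorem mem_K_three_iff {A : Type*} [Group A] (k : Fin 3 → A) :
    k ∈ K A 3 ↔ k 0 * k 1 * k 2 ∈ commutator A := by
  rw [← Abelianization.ker_of, MonoidHom.mem_ker, K, MonoidHom.mem_ker]
  simp [Fin.prod_univ_three]

/-- The map `K(F, 3) → L`. -/
def toKModel (hβ : ∀ x y, β x y * (β y x)⁻¹ = wedge x y)
    (hlam : ∀ f, (lam f).fst = π f) : K F 3 →* KModel G :=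
  MonoidHom.mk' (fun k => ⟨π ((k : Fin 3 → F) 0), π ((k : Fin 3 → F) 1),
    (lam ((k : Fin 3 → F) 0 * (k : Fin 3 → F) 1 * (k : Fin 3 → F) 2)).snd⟩) (by
    rintro ⟨k, hk⟩ ⟨l, hl⟩
    have hπc : ∀ m : Fin 3 → F, m ∈ K F 3 → π (m 2) = (π (m 0) * π (m 1))⁻¹ := by
      intro m hm
      rw [mem_K_three_iff] at hm
      have h : commutator F ≤ π.ker := Abelianization.commutator_subset_ker π
      have h1 : π (m 0 * m 1 * m 2) = 1 := h hm
      rw [map_mul, map_mul] at h1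
      exact eq_inv_of_mul_eq_one_right h1
    refine KModel.ext (map_mul _ _ _) (map_mul _ _ _) ?_
    change (lam (k 0 * l 0 * (k 1 * l 1) * (k 2 * l 2))).snd =
      (lam (k 0 * k 1 * k 2)).snd * (lam (l 0 * l 1 * l 2)).snd *
        wedge (π (k 0)) (π (l 0) * π (l 1)) * wedge (π (k 1)) (π (l 1))
    -- With `π (m 2)` eliminated, the cocycle terms mixing `k` and `l` cancel down to the skew parts
    -- for `(k 0, l 0)`, `(k 0, l 1)` and `(k 1, l 1)`, which is the cocycle of `L`.
    rw [← hβ, ← hβ]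
    simp only [map_mul, BiExt.mul_snd, BiExt.mul_fst, hlam, hπc k hk, hπc l hl, map_inv,
      MonoidHom.mul_apply, MonoidHom.inv_apply]
    apply Additive.ofMul.injective
    simp only [ofMul_mul, ofMul_inv]
    abel)

/-- The tuples in `N^3` with product in `F'` and trivial image in `G ∧ G`. -/
def trivialTuples (hlam : ∀ f, (lam f).fst = π f) : Subgroup (Fin 3 → F) where
  carrier := {k | (∀ i, k i ∈ π.ker) ∧ k ∈ K F 3 ∧ ∏ i, (lam (k i)).snd = 1}
  one_mem' := ⟨fun _ => one_mem _, one_mem _, by simp⟩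
  mul_mem' := by
    rintro k l ⟨h1, h2, h3⟩ ⟨h1', h2', h3'⟩
    refine ⟨fun i => mul_mem (h1 i) (h1' i), mul_mem h2 h2', ?_⟩
    have : ∀ i, (lam ((k * l) i)).snd = (lam (k i)).snd * (lam (l i)).snd := fun i => by
      simp [hlam, MonoidHom.mem_ker.mp (h1 i)]
    simp only [this, Finset.prod_mul_distrib, h3, h3', one_mul]
  inv_mem' := by
    rintro k ⟨h1, h2, h3⟩
    refine ⟨fun i => inv_mem (h1 i), inv_mem h2, ?_⟩
    have : ∀ i, (lam (k⁻¹ i)).snd = (lam (k i)).snd⁻¹ := fun i => by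
      simp [hlam, MonoidHom.mem_ker.mp (h1 i)]
    simp only [this, Finset.prod_inv_distrib, h3, inv_one]

/-- Elements of `N` have central image under `lam`, so conjugation in `F^3` leaves the values `lam
(k i)` unchanged. -/
theorem trivialTuples_normal (hlam : ∀ f, (lam f).fst = π f) :
    (trivialTuples hlam).Normal := by
  refine ⟨?_⟩
  rintro k ⟨h1, h2, h3⟩ g
  refine ⟨fun i => (inferInstance : π.ker.Normal).conj_mem _ (h1 i) _, ?_, ?_⟩
  · have h : (K F 3).Normal := MonoidHom.normal_ker _
    exact h.conj_mem _ h2 _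
  · rw [← h3]
    refine Finset.prod_congr rfl fun i _ => ?_
    have hc : Commute (lam (k i)) (lam (g i)) :=
      BiExt.commute_of_fst_eq_one (by rw [hlam]; exact h1 i) _
    have : lam ((g * k * g⁻¹) i) = lam (k i) := by
      simp [← hc.eq]
    rw [this]

/-- On `N` the second component of `lam` is a homomorphism to an abelian group, hence kills `N'`. -/
theorem KSub_le_trivialTuples (hlam : ∀ f, (lam f).fst = π f) :
    KSub π.ker 3 ≤ trivialTuples hlam := by
  rintro _ ⟨k, hk, rfl⟩
  let t : π.ker →* extSq G := MonoidHom.mk' (fun n => (lam n).snd) fun n m => by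
    have : π n = 1 := n.2
    simp [hlam, this]
  refine ⟨fun i => (k i).2, ?_, ?_⟩
  · rw [mem_K_three_iff]
    have hk' := (mem_K_three_iff k).mp hk
    have : (commutator π.ker).map π.ker.subtype ≤ commutator F := by
      rw [commutator_def, Subgroup.map_commutator]
      exact Subgroup.commutator_mono le_top le_top
    exact this (Subgroup.mem_map_of_mem _ hk')
  · have h : commutator π.ker ≤ t.ker := Abelianization.commutator_subset_ker t
    have h1 : t (k 0 * k 1 * k 2) = 1 := h ((mem_K_three_iff k).mp hk)
    rw [map_mul, map_mul] at h1
    rw [Fin.prod_univ_three]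
    exact h1

theorem mem_normalClosure_of_mem_commutator (N : Subgroup F) [N.Normal] {k : Fin 3 → F}
    (h0 : k 0 ∈ N) (h1 : k 1 ∈ N) (hk : k 0 * k 1 * k 2 ∈ ⁅N, (⊤ : Subgroup F)⁆) :
    k ∈ Subgroup.normalClosure (KSub N 3 : Set (Fin 3 → F)) := by
  set M := Subgroup.normalClosure (KSub N 3 : Set (Fin 3 → F))
  have hbase : ∀ a b c : N, a * b * c = 1 → (![(a : F), b, c] : Fin 3 → F) ∈ M := by
    intro a b c h
    refine Subgroup.subset_normalClosure ⟨![a, b, c], ?_, ?_⟩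
    · rw [SetLike.mem_coe, mem_K_three_iff]
      simp [h]
    · ext i
      fin_cases i <;> rfl
  have hR : ∀ w ∈ ⁅N, (⊤ : Subgroup F)⁆, (![1, 1, w] : Fin 3 → F) ∈ M := by
    have hsub : ⁅N, (⊤ : Subgroup F)⁆ ≤ M.comap (MonoidHom.mulSingle (fun _ : Fin 3 => F) 2) := by
      rw [Subgroup.commutator_le]
      intro n hn f _
      -- The tuple `(1, 1, [n, f])` is `(n⁻¹, 1, n)` times the conjugate of `(n, 1, n⁻¹)` by `(1, 1,
      -- f)`.
      have ha := hbase ⟨n⁻¹, inv_mem hn⟩ 1 ⟨n, hn⟩ (by ext; simp)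
      have hb := (inferInstance : M.Normal).conj_mem _
        (hbase ⟨n, hn⟩ 1 ⟨n⁻¹, inv_mem hn⟩ (by ext; simp)) ![1, 1, f]
      have := mul_mem ha hb
      rw [Subgroup.mem_comap]
      convert this using 1
      ext i
      fin_cases i <;> simp [commutatorElement_def, mul_assoc]
    intro w hw
    have := hsub hw
    rw [Subgroup.mem_comap] at this
    convert this using 1
    ext i
    fin_cases i <;> simp
  -- Factor `k` as `(1, k 1, (k 1)⁻¹) (k 0, 1, (k 0)⁻¹) (1, 1, k 0 * k 1 * k 2)`. This order makes
  -- the third coordinates multiply to `k 2`.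
  have ha := hbase 1 ⟨k 1, h1⟩ ⟨(k 1)⁻¹, inv_mem h1⟩ (by ext; simp)
  have hb := hbase ⟨k 0, h0⟩ 1 ⟨(k 0)⁻¹, inv_mem h0⟩ (by ext; simp)
  convert mul_mem (mul_mem ha hb) (hR _ hk) using 1
  ext i
  fin_cases i <;> simp [mul_assoc]

theorem ker_toKModel (hπ : Function.Surjective π)
    (hβ : ∀ x y, β x y * (β y x)⁻¹ = wedge x y) (hlam : ∀ f, (lam f).fst = π f) :
    (Subgroup.normalClosure (KSub π.ker 3 : Set (Fin 3 → F))).subgroupOf (K F 3) =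
      (toKModel hβ hlam).ker := by
  have := trivialTuples_normal hlam
  apply le_antisymm
  · rintro ⟨k, hk⟩ hkM
    have h : k ∈ trivialTuples hlam :=
      Subgroup.normalClosure_le_normal (KSub_le_trivialTuples hlam) hkM
    obtain ⟨h1, -, h3⟩ := h
    have h1' : ∀ i, π (k i) = 1 := h1
    refine KModel.ext (h1 0) (h1 1) ?_
    change (lam (k 0 * k 1 * k 2)).snd = 1
    rw [← h3, Fin.prod_univ_three]
    simp [hlam, h1']
  · rintro ⟨k, hk⟩ hker
    have h0 : π (k 0) = 1 := congrArg KModel.a hker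
    have h1 : π (k 1) = 1 := congrArg KModel.b hker
    have h2 : (lam (k 0 * k 1 * k 2)).snd = 1 := congrArg KModel.c hker
    exact mem_normalClosure_of_mem_commutator π.ker h0 h1
      (mem_commutator_ker_of_snd_eq_one hπ hβ hlam ((mem_K_three_iff k).mp hk) h2)

theorem toKModel_surjective (hπ : Function.Surjective π)
    (hβ : ∀ x y, β x y * (β y x)⁻¹ = wedge x y) (hlam : ∀ f, (lam f).fst = π f) :
    Function.Surjective (toKModel hβ hlam) := by
  rintro ⟨a, b, c⟩
  obtain ⟨f, rfl⟩ := hπ a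
  obtain ⟨g, rfl⟩ := hπ b
  obtain ⟨w, hw, hc⟩ := exists_mem_commutator_snd_eq hπ hβ hlam c
  refine ⟨⟨![f, g, (f * g)⁻¹ * w], (mem_K_three_iff _).mpr ?_⟩, KModel.ext rfl rfl ?_⟩
  · simpa [mul_assoc] using hw
  · change (lam (f * g * ((f * g)⁻¹ * w))).snd = c
    rw [mul_inv_cancel_left, hc]

/-- The isomorphism `K̃(G, 3) ≅ L` for a free presentation of an abelian group `G` whose symbol `∧`
is the skew part of a bimultiplicative map. -/
theorem exists_KTilde_equiv [IsFreeGroup F] (π : F →* G) (hπ : Function.Surjective π)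
    (β : G →* G →* extSq G) (hβ : ∀ x y, β x y * (β y x)⁻¹ = wedge x y) :
    ∃ e : KTilde π 3 ≃* KModel G, ∀ (k : K F 3) (f f' : F),
      (k : Fin 3 → F) 2 = ((k : Fin 3 → F) 0 * (k : Fin 3 → F) 1)⁻¹ * rcomm f f' →
      e (k : KTilde π 3) =
        ⟨π ((k : Fin 3 → F) 0), π ((k : Fin 3 → F) 1), wedge (π f) (π f')⟩ := by
  let lam : F →* BiExt β := IsFreeGroup.lift fun x => ⟨π (IsFreeGroup.of x), 1⟩
  have hlam : ∀ f, (lam f).fst = π f := by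
    -- The second components chosen on the free generators are irrelevant; only that `lam` lifts `π`
    -- is used.
    have : (BiExt.fstHom β).comp lam = π := IsFreeGroup.ext_hom fun x => by
      change (lam (IsFreeGroup.of x)).fst = _
      rw [IsFreeGroup.lift_of]
    exact fun f => DFunLike.congr_fun this f
  refine ⟨QuotientGroup.liftEquiv _ (toKModel_surjective hπ hβ hlam) (ker_toKModel hπ hβ hlam),
    fun k f f' h => ?_⟩
  refine KModel.ext rfl rfl ?_
  change (lam ((k : Fin 3 → F) 0 * (k : Fin 3 → F) 1 * (k : Fin 3 → F) 2)).snd = _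
  rw [h, mul_inv_cancel_left, lift_rcomm hβ hlam]

end Presentation

/-! ### Cyclic decompositions and triangular pairings -/

section Decomposition

variable {G : Type*} [CommGroup G]

/-- If `∧` vanishes on every component of a decomposition of `G`, then it is the skew part of its
strictly upper triangular part. -/
theorem exists_triangular_pairing {n : ℕ} (pr : Fin n → G →* G) (hpr : ∀ g, ∏ i, pr i g = g)
    (hw : ∀ i g h, wedge (pr i g) (pr i h) = 1) :
    ∃ β : G →* G →* extSq G,
      (∀ x y, β x y = ∏ i, ∏ j ∈ Finset.Ioi i, wedge (pr i x) (pr j y)) ∧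
      ∀ x y, β x y * (β y x)⁻¹ = wedge x y := by
  classical
  let β : G →* G →* extSq G :=
    ∏ i, ∏ j ∈ Finset.Ioi i, ((wedgeHom G).comp (pr i)).compl₂ (pr j)
  have hβ : ∀ x y, β x y = ∏ i, ∏ j ∈ Finset.Ioi i, wedge (pr i x) (pr j y) := by
    intro x y
    simp [β]
  refine ⟨β, hβ, fun x y => ?_⟩
  -- Inverting and swapping turns the upper triangular part at `(y, x)` into the lower triangular
  -- part at `(x, y)`. Together with `β x y` only the diagonal of the full expansion is missing, and
  -- it is trivial by `hw`.
  have h1 : (β y x)⁻¹ = ∏ j, ∏ i ∈ Finset.Iio j, wedge (pr j x) (pr i y) := by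
    rw [hβ, ← Finset.prod_inv_distrib]
    simp only [← Finset.prod_inv_distrib, ← wedge_swap]
    refine Finset.prod_comm' ?_
    simp
  have h2 : wedge x y = ∏ i, ∏ j, wedge (pr i x) (pr j y) := by
    conv_lhs => rw [← hpr x, ← hpr y]
    rw [← wedgeHom_apply]
    simp only [map_prod, MonoidHom.finsetProd_apply, wedgeHom_apply]
    exact Finset.prod_comm
  rw [h1, h2, hβ, ← Finset.prod_mul_distrib]
  refine Finset.prod_congr rfl fun i _ => ?_
  rw [← Finset.prod_erase_mul (Finset.univ) _ (Finset.mem_univ i), hw, mul_one]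
  rw [← Finset.prod_union (Finset.disjoint_left.mpr fun j hj hj' => by
    simp only [Finset.mem_Ioi, Finset.mem_Iio] at hj hj'; exact lt_asymm hj hj')]
  refine Finset.prod_congr ?_ fun _ _ => rfl
  ext j
  simp [ne_comm, lt_or_lt_iff_ne]

theorem wedge_eq_one_of_mem_zpowers {x g h : G} (hg : g ∈ Subgroup.zpowers x)
    (hh : h ∈ Subgroup.zpowers x) : wedge g h = 1 := by
  obtain ⟨m, rfl⟩ := hg
  obtain ⟨n, rfl⟩ := hh
  simp only [← wedgeHom_apply, map_zpow, MonoidHom.zpow_apply]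
  simp [wedge_self]

theorem wedge_zpow_zpow (x y : G) (m n : ℤ) : wedge (x ^ m) (y ^ n) = wedge x y ^ (m * n) := by
  simp [← wedgeHom_apply, ← zpow_mul, mul_comm]

theorem exists_projections {n : ℕ} (x : Fin n → G)
    (hx : Function.Bijective (fun y : (∀ i, Subgroup.zpowers (x i)) => ∏ i, (y i : G))) :
    ∃ pr : Fin n → G →* G, (∀ g, ∏ i, pr i g = g) ∧ (∀ i g, pr i g ∈ Subgroup.zpowers (x i)) ∧
      ∀ (a : Fin n → ℤ) i, pr i (∏ j, x j ^ a j) = x i ^ a i := by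
  let e : (∀ i, Subgroup.zpowers (x i)) ≃* G := MulEquiv.ofBijective
    (MonoidHom.mk' (fun y : (∀ i, Subgroup.zpowers (x i)) => ∏ i, (y i : G)) fun y z => by
      simp [Finset.prod_mul_distrib]) hx
  refine ⟨fun i => (Subgroup.subtype _).comp ((Pi.evalMonoidHom _ i).comp e.symm.toMonoidHom),
    fun g => e.apply_symm_apply g, fun i g => (e.symm g i).2, fun a i => ?_⟩
  have h : ∏ j, x j ^ a j = e fun j => ⟨x j ^ a j, a j, rfl⟩ := rfl
  rw [h]
  simp

/-- The structure theorem for finite abelian groups supplies the projections onto cyclic factors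
that the triangular construction needs. -/
theorem exists_skew_pairing (G : Type*) [CommGroup G] [Finite G] :
    ∃ β : G →* G →* extSq G, ∀ x y, β x y * (β y x)⁻¹ = wedge x y := by
  classical
  obtain ⟨ι, _, m, -, ⟨e⟩⟩ := CommGroup.equiv_prod_multiplicative_zmod_of_finite G
  let pr : ι → G →* G := fun i => e.symm.toMonoidHom.comp ((MonoidHom.mulSingle _ i).comp
    ((Pi.evalMonoidHom (fun i => Multiplicative (ZMod (m i))) i).comp e.toMonoidHom))
  have hpr : ∀ i g, pr i g = e.symm (Pi.mulSingle i (e g i)) := fun _ _ => rfl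
  have hsum : ∀ g, ∏ i, pr i g = g := fun g => by
    simp only [hpr]
    rw [← map_prod, Finset.univ_prod_mulSingle, e.symm_apply_apply]
  have hmem : ∀ i g, pr i g ∈
      Subgroup.zpowers (e.symm (Pi.mulSingle i (Multiplicative.ofAdd (1 : ZMod (m i))))) := by
    intro i g
    refine ⟨(Multiplicative.toAdd (e g i)).cast, ?_⟩
    simp only [hpr]
    rw [← map_zpow, ← Pi.mulSingle_zpow, ← ofAdd_zsmul]
    simp
  obtain ⟨β, -, hβ⟩ := exists_triangular_pairing (fun i => pr ((Fintype.equivFin ι).symm i))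
    (fun g => by
      rw [← hsum g, Equiv.prod_comp (Fintype.equivFin ι).symm fun i => pr i _, hsum])
    (fun i g h => wedge_eq_one_of_mem_zpowers (hmem _ g) (hmem _ h))
  exact ⟨β, hβ⟩

/-! ### Comparison of `T` and `L` -/

/-- The isomorphism `T ≅ L` attached to a bimultiplicative map with skew part `∧`. -/
theorem exists_model_equiv (hexp : Monoid.exponent (extSq G) ∣ 2) (β : G →* G →* extSq G)
    (hβ : ∀ x y, β x y * (β y x)⁻¹ = wedge x y) :
    ∃ ψ : TauModel G ≃* KModel G, ∀ a b c,
      ψ ⟨a, b, c⟩ = ⟨a, b, c * (β a a * β b b * β a b * (β b a)⁻¹)⟩ := by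
  have h2 : ∀ c : extSq G, c * c = 1 := fun c => by
    rw [← pow_two]; exact Monoid.exponent_dvd_iff_forall_pow_eq_one.mp hexp c
  have hinv : ∀ c : extSq G, c⁻¹ = c := fun c => inv_eq_of_mul_eq_one_right (h2 c)
  have h2' : ∀ c d : extSq G, c * (c * d) = d := fun c d => by rw [← mul_assoc, h2, one_mul]
  -- Modulo squares, the polarization of `q` at `(a, b)`, `(d, e)` is `(a ∧ d)(b ∧ e)(a ∧ e)(b ∧
  -- d)`. This is exactly the quotient of the cocycles `(a ∧ de)(b ∧ e)` of `L` and `b ∧ d` of `T`.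
  let q : G → G → extSq G := fun a b => β a a * β b b * β a b * (β b a)⁻¹
  let ψ : TauModel G →* KModel G := MonoidHom.mk' (fun u => ⟨u.a, u.b, u.c * q u.a u.b⟩) (by
    rintro ⟨a, b, c⟩ ⟨d, e, f⟩
    refine KModel.ext rfl rfl ?_
    change c * f * wedge b d * q (a * d) (b * e) =
      c * q a b * (f * q d e) * wedge a (d * e) * wedge b e
    rw [← hβ, ← hβ, ← hβ]
    simp only [q, hinv, map_mul, MonoidHom.mul_apply]
    generalize β a a = y1, β a b = y2, β a d = y3, β a e = y4, β b a = y5, β b b = y6,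
      β b d = y7, β b e = y8, β d a = y9, β d b = y10, β d d = y11, β d e = y12, β e a = y13,
      β e b = y14, β e d = y15, β e e = y16
    simp only [mul_left_comm, mul_comm, h2'])
  refine ⟨MulEquiv.ofBijective ψ ⟨?_, ?_⟩, fun a b c => rfl⟩
  · rintro ⟨a, b, c⟩ ⟨d, e, f⟩ h
    injection h with h3 h4 h5
    subst h3 h4
    have h6 : c = f := mul_right_cancel h5
    rw [h6]
  · rintro ⟨a, b, c⟩
    exact ⟨⟨a, b, c * (q a b)⁻¹⟩, KModel.ext rfl rfl (inv_mul_cancel_right _ _)⟩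

end Decomposition

end TauK

/-! ### Assembly -/

theorem mainTheorem6 {G : Type*} [CommGroup G] [Finite G] (hG : IsPGroup 2 G)
    (hexp : Monoid.exponent (TauK.extSq G) ∣ 2)
    {F : Type*} [Group F] [IsFreeGroup F] (π : F →* G) (hπ : Function.Surjective π) :
    Nonempty (TauK.Tau G ≃* TauK.KTilde π 3) ∧
    ∃ (eτ : TauK.Tau G ≃* TauK.TauModel G) (eK : TauK.KTilde π 3 ≃* TauK.KModel G),
      (∀ (g h : G) (w : TauK.extSq G),
        eτ (TauK.tauL G g * TauK.tauR G h * (w : TauK.Tau G)) = ⟨g, h, w⟩) ∧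
      (∀ (k : TauK.K F 3) (f f' : F),
        (k : Fin 3 → F) 2 =
          ((k : Fin 3 → F) 0 * (k : Fin 3 → F) 1)⁻¹ * TauK.rcomm f f' →
        eK (k : TauK.KTilde π 3) =
          ⟨π ((k : Fin 3 → F) 0), π ((k : Fin 3 → F) 1), TauK.wedge (π f) (π f')⟩) ∧
      (∀ (n : ℕ) (x : Fin n → G),
        Function.Bijective (fun y : (∀ i, Subgroup.zpowers (x i)) => ∏ i, (y i : G)) →
        ∃ ψ : TauK.TauModel G ≃* TauK.KModel G,
          ∀ (a b : Fin n → ℤ) (c : TauK.extSq G),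
            ψ ⟨∏ i, x i ^ a i, ∏ i, x i ^ b i, c⟩ =
              ⟨∏ i, x i ^ a i, ∏ i, x i ^ b i,
                c * ∏ i, ∏ j ∈ Finset.Ioi i, TauK.wedge (x i) (x j) ^
                  (a i * a j + b i * b j + a i * b j - a j * b i)⟩) := by
  obtain ⟨β, hβ⟩ := TauK.exists_skew_pairing G
  obtain ⟨eτ, heτ⟩ := TauK.exists_tau_equiv G
  obtain ⟨eK, heK⟩ := TauK.exists_KTilde_equiv π hπ β hβ
  obtain ⟨ψ₀, -⟩ := TauK.exists_model_equiv hexp β hβ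
  refine ⟨⟨(eτ.trans ψ₀).trans eK.symm⟩, eτ, eK, heτ, heK, fun n x hx => ?_⟩
  obtain ⟨pr, hpr, hmem, hpw⟩ := TauK.exists_projections x hx
  -- The explicit formula needs a pairing triangular for the given generators, which need not be
  -- those behind `β`. This is harmless: the `L`-coordinates of the prescribed classes do not
  -- involve `β`.
  obtain ⟨γ, hγ, hγ'⟩ := TauK.exists_triangular_pairing pr hpr fun i g h =>
    TauK.wedge_eq_one_of_mem_zpowers (hmem i g) (hmem i h)
  obtain ⟨ψ, hψ⟩ := TauK.exists_model_equiv hexp γ hγ'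
  refine ⟨ψ, fun a b c => ?_⟩
  rw [hψ]
  simp only [hγ, hpw, TauK.wedge_zpow_zpow]
  simp only [← Finset.prod_inv_distrib, ← Finset.prod_mul_distrib, ← zpow_neg, ← zpow_add]
  simp only [sub_eq_add_neg, mul_comm]
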